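/- Let $G$ be a torsion nilpotent group (of any nilpotency class), let $\phi\colon G\to G$ be a group endomorphism, and let $H$ be a normal subgroup of $G$ with $\phi(H)\subseteq H$. Denote by $\phi\upharpoonright_H\colon H\to H$ the restriction of $\phi$ and by $\bar\phi\colon G/H\to G/H$, $xH\mapsto\phi(x)H$, the induced endomorphism. Then $$h(\phi)=h(\phi\upharpoonright_H)+h(\bar\phi)\quad\text{in }[0,\infty].$$ Here, for an endomorphism $\psi$ of a group $K$ in which every finitely generated subgroup is finite (as holds for $G$, $H$ and $G/H$), the algebraic entropy is $$h(\psi)=\sup\Big\{\lim_{n\to\infty}\tfrac1n\log\bigl|F\,\psi(F)\cdots\psi^{n-1}(F)\bigr| : F\le K\text{ a finite subgroup}\Big\}\in[0,\infty],$$ where $F\,\psi(F)\cdots\psi^{n-1}(F)$ is the product of subsets of $K$; the limit exists for every $F$ by subadditivity. -/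

import Mathlib

open scoped Pointwise

namespace AlgEntropy

/-- The `n`-th trajectory `T_n(φ, F) = F · φ(F) ⋯ φ^{n-1}(F)`, a product of subsets of `G` in this
order (`T_0 = {1}`). -/
def trajectory {G : Type*} [Group G] (φ : G →* G) (F : Subgroup G) (n : ℕ) : Set G :=
  ((List.range n).map fun i => φ^[i] '' (F : Set G)).prod

/-- The algebraic entropy `H(φ, F) = lim_{n → ∞} (1/n) log |T_n(φ, F)|` of `φ` with respect to a
finite subgroup `F`. The limit exists by `tendsto_entropyAt` below. -/
noncomputable def entropyAt {G : Type*} [Group G] (φ : G →* G) (F : Subgroup G) : ℝ :=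
  Filter.limUnder Filter.atTop fun n : ℕ => Real.log ((trajectory φ F n).ncard) / (n : ℝ)

/-- The algebraic entropy `h(φ) = sup {H(φ, F) : F ≤ G a finite subgroup}`, with values
in `[0, ∞]`; no truncation occurs, because `H(φ, F) ≥ 0` by `entropyAt_nonneg` below. -/
noncomputable def entropy {G : Type*} [Group G] (φ : G →* G) : ENNReal :=
  ⨆ (F : Subgroup G) (_ : Finite F), ENNReal.ofReal (entropyAt φ F)

/-- The restriction `φ ↾ H` of `φ` to a `φ`-invariant subgroup `H`. -/
def restrictEnd {G : Type*} [Group G] (φ : G →* G) (H : Subgroup G) (hH : ∀ x ∈ H, φ x ∈ H) :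
    H →* H :=
  (φ.comp H.subtype).codRestrict H fun x => hH x x.2

/-- The endomorphism `xH ↦ φ(x)H` of `G / H` induced by `φ`, for a `φ`-invariant normal
subgroup `H`. -/
def quotientEnd {G : Type*} [Group G] (φ : G →* G) (H : Subgroup G) [H.Normal]
    (hH : ∀ x ∈ H, φ x ∈ H) : G ⧸ H →* G ⧸ H :=
  QuotientGroup.map H H φ hH

section Limit

variable {G : Type*} [Group G] (φ : G →* G) (F : Subgroup G)

theorem trajectory_zero : trajectory φ F 0 = {1} := by
  simp only [trajectory, List.range_zero, List.map_nil, List.prod_nil]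
  rfl

theorem trajectory_succ (n : ℕ) :
    trajectory φ F (n + 1) = trajectory φ F n * φ^[n] '' (F : Set G) := by
  simp [trajectory, List.range_succ]

theorem trajectory_finite [Finite F] (n : ℕ) : (trajectory φ F n).Finite := by
  induction n with
  | zero => simp [trajectory_zero]
  | succ n ih =>
    rw [trajectory_succ]
    exact ih.mul ((Set.toFinite (F : Set G)).image _)

theorem one_mem_trajectory (n : ℕ) : (1 : G) ∈ trajectory φ F n := by
  induction n with
  | zero => simp [trajectory_zero]
  | succ n ih =>
    rw [trajectory_succ]
    exact ⟨1, ih, 1, ⟨1, F.one_mem, by simp⟩, by simp⟩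

theorem trajectory_add (m n : ℕ) :
    trajectory φ F (m + n) = trajectory φ F m * φ^[m] '' trajectory φ F n := by
  induction n with
  | zero => simp [trajectory_zero]
  | succ n ih =>
    have key : ∀ A B : Set G, φ^[m] '' (A * B) = φ^[m] '' A * φ^[m] '' B := fun A B => by
      have := Set.image_mul (s := A) (t := B) ((show Monoid.End G from φ) ^ m)
      rwa [Monoid.End.coe_pow] at this
    rw [← add_assoc, trajectory_succ, ih, trajectory_succ, key, mul_assoc, Function.iterate_add,
      Set.image_comp]

theorem one_le_ncard_trajectory [Finite F] (n : ℕ) : 1 ≤ (trajectory φ F n).ncard :=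
  (Set.ncard_pos (trajectory_finite φ F n)).2 ⟨1, one_mem_trajectory φ F n⟩

theorem subadditive_log_ncard [Finite F] :
    Subadditive fun n => Real.log ((trajectory φ F n).ncard) := by
  intro m n
  have hm := one_le_ncard_trajectory φ F m
  have hn := one_le_ncard_trajectory φ F n
  have hmn := one_le_ncard_trajectory φ F (m + n)
  have h : (trajectory φ F (m + n)).ncard ≤
      (trajectory φ F m).ncard * (trajectory φ F n).ncard := by
    rw [trajectory_add]
    calc _ ≤ (trajectory φ F m).ncard * (φ^[m] '' trajectory φ F n).ncard := by
          simpa only [Nat.card_coe_set_eq] using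
            Set.natCard_mul_le (s := trajectory φ F m) (t := φ^[m] '' trajectory φ F n)
      _ ≤ _ := Nat.mul_le_mul_left _ (Set.ncard_image_le (trajectory_finite φ F n))
  rw [← Real.log_mul (by positivity) (by positivity)]
  exact Real.log_le_log (by positivity) (by exact_mod_cast h)

theorem tendsto_entropyAt [Finite F] :
    Filter.Tendsto (fun n : ℕ => Real.log ((trajectory φ F n).ncard) / (n : ℝ)) Filter.atTop
      (nhds (entropyAt φ F)) := by
  refine tendsto_nhds_limUnder ⟨_, (subadditive_log_ncard φ F).tendsto_lim ⟨0, ?_⟩⟩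
  rintro _ ⟨n, rfl⟩
  exact div_nonneg (Real.log_natCast_nonneg _) n.cast_nonneg

theorem entropyAt_nonneg [Finite F] : 0 ≤ entropyAt φ F :=
  ge_of_tendsto' (tendsto_entropyAt φ F) fun n =>
    div_nonneg (Real.log_natCast_nonneg _) n.cast_nonneg

end Limit

end AlgEntropy

open scoped Pointwise

universe u v

namespace AlgEntropy

/-! ### Trajectories under homomorphisms -/

section Trajectory

variable {G K : Type*} [Group G] [Group K] {φ : G →* G} {ψ : K →* K}

/-! The core is the case of a central torsion subgroup `A`. If `F` contains `E ≤ A`, centrality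
makes `T_n(F)` absorb `T_n(E)`, so `T_n(F)` contains a translate of `T_n(E)` over each point of
`T_n(π F)`; this gives `≥`. For `≤`, fix `N`: elements of `T_N(F)` differ from chosen lifts of their
images by finitely many elements of `A`, which generate a finite `E`. Hence `T_{Nm}(F)` is covered
by `|T_N(π F)|^m` translates of `T_{Nm}(E)`; let `m → ∞`, then `N → ∞`. The general case is by
induction on the class. For `Z` the last nontrivial term of the lower central series, four central
extensions split the entropies on `G`, `B`, `A` and `Z`, and the induction hypothesis splits the one
on `G / Z`. Only sums are rearranged, so infinite values are harmless. -/

theorem image_trajectory (f : G →* K) (h : ∀ x, f (φ x) = ψ (f x)) (F : Subgroup G) (n : ℕ) :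
    f '' trajectory φ F n = trajectory ψ (F.map f) n := by
  induction n with
  | zero => simp [trajectory_zero]
  | succ n ih =>
    have hs : Function.Semiconj f φ ψ := h
    rw [trajectory_succ, trajectory_succ, Set.image_mul, ih, Set.image_image, Subgroup.coe_map,
      Set.image_image]
    congr 1
    exact Set.image_congr fun x _ => (hs.iterate_right n).eq x

theorem trajectory_mono (φ : G →* G) (F : Subgroup G) : Monotone (trajectory φ F) := by
  refine monotone_nat_of_le_succ fun n x hx => ?_
  rw [trajectory_succ]
  exact ⟨x, hx, 1, ⟨1, F.one_mem, by simp⟩, by simp⟩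

theorem ofReal_entropyAt_le_entropy (φ : G →* G) (F : Subgroup G) [hF : Finite F] :
    ENNReal.ofReal (entropyAt φ F) ≤ entropy φ :=
  le_iSup₂ (f := fun (F : Subgroup G) (_ : Finite F) => ENNReal.ofReal (entropyAt φ F)) F hF

end Trajectory

/-! ### Extensions of endomorphisms -/

/-- The sequence `1 → A → G → B → 1` given by `i` and `π` is exact and compatible with the
endomorphisms `α`, `φ` and `β` of `A`, `G` and `B`. -/
structure IsFlowExtension {A G B : Type*} [Group A] [Group G] [Group B] (i : A →* G) (π : G →* B)
    (α : A →* A) (φ : G →* G) (β : B →* B) : Prop where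
  injective : Function.Injective i
  surjective : Function.Surjective π
  exact : ∀ g, π g = 1 ↔ ∃ a, i a = g
  comm_left : ∀ a, i (α a) = φ (i a)
  comm_right : ∀ g, π (φ g) = β (π g)

theorem isFlowExtension_subgroup {G : Type*} [Group G] (φ : G →* G) (H : Subgroup G) [H.Normal]
    (hH : ∀ x ∈ H, φ x ∈ H) :
    IsFlowExtension H.subtype (QuotientGroup.mk' H) (restrictEnd φ H hH) φ (quotientEnd φ H hH) where
  injective := H.subtype_injective
  surjective := QuotientGroup.mk'_surjective H
  exact g := by simp
  comm_left _ := rfl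
  comm_right _ := rfl

namespace IsFlowExtension

variable {A G B : Type*} [Group A] [Group G] [Group B] {i : A →* G} {π : G →* B}
  {α : A →* A} {φ : G →* G} {β : B →* B}

theorem ker_eq_range (h : IsFlowExtension i π α φ β) : π.ker = i.range := by
  ext g
  rw [MonoidHom.mem_ker, MonoidHom.mem_range, h.exact]

theorem map_map_eq_one (h : IsFlowExtension i π α φ β) (a : A) : π (i a) = 1 :=
  (h.exact _).2 ⟨a, rfl⟩

theorem iterate_left (h : IsFlowExtension i π α φ β) (n : ℕ) (a : A) :
    i (α^[n] a) = φ^[n] (i a) :=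
  (Function.Semiconj.iterate_right (f := i) (ga := α) (gb := φ) h.comm_left n).eq a

theorem mul_comm_left (h : IsFlowExtension i π α φ β) (hc : i.range ≤ Subgroup.center G)
    (a b : A) : a * b = b * a :=
  h.injective (by
    rw [map_mul, map_mul]
    exact (Subgroup.mem_center_iff.1 (hc ⟨a, rfl⟩) (i b)).symm)

theorem finite_of_fg (h : IsFlowExtension i π α φ β) (hc : i.range ≤ Subgroup.center G)
    (hA : IsMulTorsion A) (E : Subgroup A) [Group.FG E] : Finite E := by
  let _ : CommGroup E :=
    { (inferInstance : Group E) with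
      mul_comm := fun a b => Subtype.ext (h.mul_comm_left hc a b) }
  refine CommGroup.finite_of_fg_isMulTorsion E fun a => ?_
  exact (E.subtype_injective.isOfFinOrder_iff (x := a)).1 (hA a)

/-! ### Central extensions: superadditivity -/

theorem trajectory_mul_image_subset (h : IsFlowExtension i π α φ β)
    (hc : i.range ≤ Subgroup.center G) {F : Subgroup G} {E : Subgroup A} (hEF : E.map i ≤ F)
    (n : ℕ) : trajectory φ F n * i '' trajectory α E n ⊆ trajectory φ F n := by
  induction n with
  | zero => simp [trajectory_zero]
  | succ n ih =>
    rw [trajectory_succ, trajectory_succ]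
    rintro _ ⟨_, ⟨x, hx, _, ⟨f, hf, rfl⟩, rfl⟩, _, ⟨_, ⟨y, hy, _, ⟨e, he, rfl⟩, rfl⟩, rfl⟩, rfl⟩
    refine ⟨x * i y, ih ⟨x, hx, _, ⟨y, hy, rfl⟩, rfl⟩, _,
      ⟨f * i e, F.mul_mem hf (hEF ⟨e, he, rfl⟩), rfl⟩, ?_⟩
    -- Centrality moves `i y` past the last factor, so `e` merges with `f` inside `F`.
    have hy' := Subgroup.mem_center_iff.1 (hc ⟨y, rfl⟩) (φ^[n] f)
    simp only [map_mul, h.iterate_left, iterate_map_mul]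
    simp only [mul_assoc]
    rw [← mul_assoc (i y), ← hy', mul_assoc]

/-- With lifts `s b` chosen inside the trajectory, `(a, b) ↦ s b * i a` is injective: `π` recovers
`b`, and cancellation recovers `a`. -/
theorem ncard_mul_ncard_le (h : IsFlowExtension i π α φ β)
    (hc : i.range ≤ Subgroup.center G) {F : Subgroup G} [Finite F] {E : Subgroup A}
    (hEF : E.map i ≤ F) (n : ℕ) :
    (trajectory α E n).ncard * (trajectory β (F.map π) n).ncard ≤ (trajectory φ F n).ncard := by
  have hs : ∀ y : trajectory β (F.map π) n, ∃ x ∈ trajectory φ F n, π x = y := by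
    rintro ⟨y, hy⟩
    rwa [← image_trajectory π h.comm_right] at hy
  choose s hs hπ using hs
  have : Finite (trajectory φ F n) := trajectory_finite φ F n
  simp only [← Nat.card_coe_set_eq]
  rw [← Nat.card_prod]
  refine Nat.card_le_card_of_injective
    (fun p : trajectory α E n × trajectory β (F.map π) n =>
      (⟨s p.2 * i p.1, h.trajectory_mul_image_subset hc hEF n
        ⟨_, hs p.2, _, ⟨p.1, p.1.2, rfl⟩, rfl⟩⟩ : trajectory φ F n)) ?_
  rintro ⟨a, b⟩ ⟨a', b'⟩ hab
  have hab : s b * i a = s b' * i a' := congrArg Subtype.val hab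
  have hb : b = b' := by
    have := congrArg π hab
    rw [map_mul, map_mul, h.map_map_eq_one, h.map_map_eq_one, mul_one, mul_one, hπ, hπ] at this
    exact Subtype.ext this
  subst hb
  rw [Prod.mk.injEq]
  exact ⟨Subtype.ext (h.injective (mul_left_cancel hab)), rfl⟩

theorem entropyAt_add_entropyAt_le (h : IsFlowExtension i π α φ β)
    (hc : i.range ≤ Subgroup.center G) {F : Subgroup G} [Finite F] {E : Subgroup A}
    (hEF : E.map i ≤ F) : entropyAt α E + entropyAt β (F.map π) ≤ entropyAt φ F := by
  have : Finite (E.map i) := Finite.of_injective _ (Subgroup.inclusion_injective hEF)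
  have : Finite E := Finite.of_injective _ (E.equivMapOfInjective i h.injective).injective
  have : Finite (F.map π) := Finite.of_surjective _ (π.subgroupMap_surjective F)
  refine le_of_tendsto_of_tendsto' ((tendsto_entropyAt α E).add (tendsto_entropyAt β (F.map π)))
    (tendsto_entropyAt φ F) fun n => ?_
  have hE := one_le_ncard_trajectory α E n
  have hF := one_le_ncard_trajectory β (F.map π) n
  rw [← add_div, ← Real.log_mul (by positivity) (by positivity)]
  gcongr
  exact_mod_cast h.ncard_mul_ncard_le hc hEF n

/-- Finite subgroups of `A` and `B` come from a common finite subgroup of the central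
extension `G`. -/
theorem exists_finite_lift (h : IsFlowExtension i π α φ β) (hc : i.range ≤ Subgroup.center G)
    (hA : IsMulTorsion A) (E : Subgroup A) [Finite E] (D : Subgroup B) [Finite D] :
    ∃ F : Subgroup G, Finite F ∧ E.map i ≤ F ∧ F.map π = D := by
  choose s hs using h.surjective
  set S : Set G := s '' (D : Set B) ∪ i '' (E : Set A) with hS
  have hSfin : S.Finite := ((Set.toFinite _).image _).union ((Set.toFinite _).image _)
  set F : Subgroup G := Subgroup.closure S with hF
  have hmap : F.map π = D := by
    refine le_antisymm ?_ fun d hd => ⟨s d, Subgroup.subset_closure (Or.inl ⟨d, hd, rfl⟩), hs d⟩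
    rw [Subgroup.map_le_iff_le_comap, hF, Subgroup.closure_le]
    rintro _ (⟨d, hd, rfl⟩ | ⟨a, _, rfl⟩)
    · simpa [hs] using hd
    · simp [h.map_map_eq_one]
  refine ⟨F, ?_, ?_, hmap⟩
  · have : Finite S := hSfin
    have : Group.FG F := Group.closure_finite_fg S
    let p : F →* F.map π := π.subgroupMap F
    have : Finite (F.map π) := hmap ▸ ‹Finite D›
    have : Finite p.range := inferInstance
    -- A finite-index subgroup of a finitely generated group is finitely generated. This kernel is
    -- the part of `F` lying in the torsion abelian group `A`, so it is finite.
    have : p.ker.FiniteIndex := Subgroup.finiteIndex_ker p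
    have : Group.FG p.ker := Subgroup.fg_of_index_ne_zero p.ker
    let e : F.comap i →* p.ker :=
      ((i.subgroupComap F)).codRestrict p.ker fun a => Subtype.ext (h.map_map_eq_one a)
    have he : Function.Bijective e := by
      constructor
      · intro a b hab
        refine Subtype.ext (h.injective ?_)
        exact congrArg (fun x : p.ker => (x : G)) hab
      · rintro ⟨⟨x, hx⟩, hxp⟩
        obtain ⟨a, rfl⟩ := (h.exact x).1 (congrArg Subtype.val (MonoidHom.mem_ker.1 hxp))
        exact ⟨⟨a, hx⟩, rfl⟩
    let e' := MulEquiv.ofBijective e he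
    have : Group.FG (F.comap i) :=
      Group.fg_of_surjective (f := e'.symm.toMonoidHom) e'.symm.surjective
    have : Finite (F.comap i) := h.finite_of_fg hc hA _
    have : Finite p.ker := Finite.of_equiv _ e'.toEquiv
    have : Finite (F ⧸ p.ker) := inferInstance
    exact Finite.of_subgroup_quotient (H := p.ker)
  · rintro _ ⟨a, ha, rfl⟩
    exact Subgroup.subset_closure (Or.inr ⟨a, ha, rfl⟩)

theorem entropy_add_entropy_le (h : IsFlowExtension i π α φ β)
    (hc : i.range ≤ Subgroup.center G) (hA : IsMulTorsion A) :
    entropy α + entropy β ≤ entropy φ := by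
  have key : ∀ E : Subgroup A, Finite E → ∀ D : Subgroup B, Finite D →
      ENNReal.ofReal (entropyAt α E) + ENNReal.ofReal (entropyAt β D) ≤ entropy φ := by
    intro E _ D _
    obtain ⟨F, _, hEF, rfl⟩ := h.exists_finite_lift hc hA E D
    rw [← ENNReal.ofReal_add (entropyAt_nonneg _ _) (entropyAt_nonneg _ _)]
    exact (ENNReal.ofReal_le_ofReal (h.entropyAt_add_entropyAt_le hc hEF)).trans
      (ofReal_entropyAt_le_entropy φ F)
  exact ENNReal.biSup_add_biSup_le' (p := fun E : Subgroup A => Finite E)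
    (q := fun D : Subgroup B => Finite D) ⟨⊥, inferInstance⟩ ⟨⊥, inferInstance⟩ key

/-! ### Central extensions: subadditivity -/

/-- A long trajectory in a central extension is covered by few translates of a trajectory in the
central subgroup. -/
theorem exists_trajectory_subset (h : IsFlowExtension i π α φ β)
    (hc : i.range ≤ Subgroup.center G) (hA : IsMulTorsion A) (F : Subgroup G) [Finite F] {N : ℕ}
    (hN : N ≠ 0) :
    ∃ E : Subgroup A, Finite E ∧ ∀ m, ∃ S : Set G, S.Finite ∧
      S.ncard ≤ (trajectory β (F.map π) N).ncard ^ m ∧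
      trajectory φ F (N * m) ⊆ S * i '' trajectory α E (N * m) := by
  have hs : ∀ y : B, ∃ x, π x = y := h.surjective
  choose s hs using hs
  -- `d x` is the discrepancy in `A` between `x` and the chosen lift of `π x`.
  have hd : ∀ x : G, ∃ a, i a = (s (π x))⁻¹ * x := fun x =>
    (h.exact _).1 (by rw [map_mul, map_inv, hs, inv_mul_cancel])
  choose d hd using hd
  have hT := trajectory_finite φ F N
  have : Finite (d '' trajectory φ F N) := hT.image d
  have : Group.FG (Subgroup.closure (d '' trajectory φ F N)) := Group.closure_finite_fg _
  have : Finite (F.map π) := Finite.of_surjective _ (π.subgroupMap_surjective F)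
  have hT' := trajectory_finite β (F.map π) N
  refine ⟨Subgroup.closure (d '' trajectory φ F N), h.finite_of_fg hc hA _, fun m => ?_⟩
  set E := Subgroup.closure (d '' trajectory φ F N) with hE
  induction m with
  | zero => exact ⟨{1}, Set.finite_singleton 1, by simp, by simp [trajectory_zero]⟩
  | succ m ih =>
    obtain ⟨S, hSf, hS, hsub⟩ := ih
    have hR := (hT'.image s).image φ^[N * m]
    refine ⟨S * φ^[N * m] '' (s '' trajectory β (F.map π) N), hSf.mul hR, ?_, ?_⟩
    · calc _ ≤ S.ncard * (φ^[N * m] '' (s '' trajectory β (F.map π) N)).ncard := by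
            simpa only [Nat.card_coe_set_eq] using Set.natCard_mul_le
              (s := S) (t := φ^[N * m] '' (s '' trajectory β (F.map π) N))
        _ ≤ _ := by
            rw [pow_succ]
            exact Nat.mul_le_mul hS
              ((Set.ncard_image_le (hT'.image s)).trans (Set.ncard_image_le hT'))
    · rw [Nat.mul_succ, trajectory_add]
      rintro _ ⟨_, hx, _, ⟨t, ht, rfl⟩, rfl⟩
      obtain ⟨u, hu, _, ⟨a, ha, rfl⟩, rfl⟩ := hsub hx
      refine ⟨u * φ^[N * m] (s (π t)), ⟨u, hu, _, ⟨_, ⟨π t, ?_, rfl⟩, rfl⟩, rfl⟩, _,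
        ⟨a * α^[N * m] (d t), ?_, rfl⟩, ?_⟩
      · rw [← image_trajectory π h.comm_right]
        exact ⟨t, ht, rfl⟩
      -- A block of length `N` adds only one factor, `α^[N * m] (d t)`, so length `N * m + 1 ≤ N * m
      -- + N` suffices.
      · refine trajectory_mono α E (Nat.add_le_add_left (Nat.one_le_iff_ne_zero.2 hN) _) ?_
        rw [trajectory_succ]
        exact ⟨a, ha, _, ⟨d t, Subgroup.subset_closure ⟨t, ht, rfl⟩, rfl⟩, rfl⟩
      · have ha' := Subgroup.mem_center_iff.1 (hc ⟨a, rfl⟩) (φ^[N * m] (s (π t)))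
        have ht' : t = s (π t) * i (d t) := by rw [hd, mul_inv_cancel_left]
        rw [map_mul, h.iterate_left]
        conv_rhs => rw [ht', iterate_map_mul]
        simp only [mul_assoc]
        rw [← mul_assoc (i a), ← ha', mul_assoc]

theorem exists_entropyAt_le (h : IsFlowExtension i π α φ β)
    (hc : i.range ≤ Subgroup.center G) (hA : IsMulTorsion A) (F : Subgroup G) [Finite F] {N : ℕ}
    (hN : N ≠ 0) :
    ∃ E : Subgroup A, Finite E ∧
      entropyAt φ F ≤ Real.log (trajectory β (F.map π) N).ncard / N + entropyAt α E := by
  obtain ⟨E, _, hE⟩ := h.exists_trajectory_subset hc hA F hN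
  refine ⟨E, ‹_›, ?_⟩
  have : Finite (F.map π) := Finite.of_surjective _ (π.subgroupMap_surjective F)
  have hlim : Filter.Tendsto (fun m : ℕ => N * m) Filter.atTop Filter.atTop :=
    Filter.tendsto_id.const_mul_atTop' (Nat.pos_of_ne_zero hN)
  refine le_of_tendsto_of_tendsto ((tendsto_entropyAt φ F).comp hlim)
    (((tendsto_entropyAt α E).comp hlim).const_add _) ?_
  filter_upwards [Filter.eventually_ne_atTop 0] with m hm
  obtain ⟨S, hSf, hS, hsub⟩ := hE m
  have hTE := trajectory_finite α E (N * m)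
  have hcard : (trajectory φ F (N * m)).ncard ≤
      (trajectory β (F.map π) N).ncard ^ m * (trajectory α E (N * m)).ncard := by
    calc _ ≤ (S * i '' trajectory α E (N * m)).ncard :=
          Set.ncard_le_ncard hsub (hSf.mul (hTE.image i))
      _ ≤ S.ncard * (i '' trajectory α E (N * m)).ncard := by
          simpa only [Nat.card_coe_set_eq] using Set.natCard_mul_le
            (s := S) (t := i '' trajectory α E (N * m))
      _ ≤ _ := Nat.mul_le_mul hS (Set.ncard_image_le hTE)
  have h1 := one_le_ncard_trajectory φ F (N * m)
  have h2 := one_le_ncard_trajectory β (F.map π) N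
  have h3 := one_le_ncard_trajectory α E (N * m)
  have hlog : Real.log (trajectory φ F (N * m)).ncard ≤
      m * Real.log (trajectory β (F.map π) N).ncard +
        Real.log (trajectory α E (N * m)).ncard := by
    rw [← Real.log_pow, ← Real.log_mul (by positivity) (by positivity)]
    exact Real.log_le_log (by positivity) (by exact_mod_cast hcard)
  have hN' : (N : ℝ) ≠ 0 := by exact_mod_cast hN
  have hm' : (m : ℝ) ≠ 0 := by exact_mod_cast hm
  calc Real.log (trajectory φ F (N * m)).ncard / ((N * m : ℕ) : ℝ)
      ≤ (m * Real.log (trajectory β (F.map π) N).ncard +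
        Real.log (trajectory α E (N * m)).ncard) / ((N * m : ℕ) : ℝ) := by gcongr
    _ = _ := by
      simp only [Function.comp_apply]
      rw [add_div]
      congr 1
      push_cast
      field_simp

theorem entropy_le_entropy_add (h : IsFlowExtension i π α φ β)
    (hc : i.range ≤ Subgroup.center G) (hA : IsMulTorsion A) :
    entropy φ ≤ entropy α + entropy β := by
  refine iSup₂_le fun F _ => ?_
  have : Finite (F.map π) := Finite.of_surjective _ (π.subgroupMap_surjective F)
  have hlim : Filter.Tendsto (fun N : ℕ =>
      entropy α + ENNReal.ofReal (Real.log (trajectory β (F.map π) N).ncard / N)) Filter.atTop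
      (nhds (entropy α + ENNReal.ofReal (entropyAt β (F.map π)))) :=
    (ENNReal.tendsto_ofReal (tendsto_entropyAt β (F.map π))).const_add _
  -- The subgroup `E` depends on `N`, so its entropy is bounded by `entropy α` before `N → ∞`.
  refine (ge_of_tendsto hlim ?_).trans (add_le_add_right (ofReal_entropyAt_le_entropy β _) _)
  filter_upwards [Filter.eventually_ne_atTop 0] with N hN
  obtain ⟨E, _, hE⟩ := h.exists_entropyAt_le hc hA F hN
  calc _ ≤ ENNReal.ofReal (Real.log (trajectory β (F.map π) N).ncard / N + entropyAt α E) :=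
        ENNReal.ofReal_le_ofReal hE
    _ ≤ _ := ENNReal.ofReal_add_le
    _ ≤ _ := by
      rw [add_comm]
      exact add_le_add_left (ofReal_entropyAt_le_entropy α E) _

/-- The addition theorem for central extensions by torsion groups. -/
theorem entropy_eq_of_le_center (h : IsFlowExtension i π α φ β)
    (hc : i.range ≤ Subgroup.center G) (hA : IsMulTorsion A) :
    entropy φ = entropy α + entropy β :=
  le_antisymm (h.entropy_le_entropy_add hc hA) (h.entropy_add_entropy_le hc hA)

end IsFlowExtension

/-! ### Induction on the nilpotency class -/

theorem map_mem_lowerCentralSeries {G : Type*} [Group G] (φ : G →* G) (n : ℕ) (x : G)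
    (hx : x ∈ (⊤ : Subgroup G).lowerCentralSeries n) :
    φ x ∈ (⊤ : Subgroup G).lowerCentralSeries n := by
  have : φ x ∈ ((⊤ : Subgroup G).lowerCentralSeries n).map φ := ⟨x, hx, rfl⟩
  rw [Subgroup.map_lowerCentralSeries] at this
  exact Subgroup.lowerCentralSeries_mono n le_top this

theorem lowerCentralSeries_le_center {G : Type*} [Group G] {n : ℕ}
    (hn : (⊤ : Subgroup G).lowerCentralSeries (n + 1) = ⊥) :
    (⊤ : Subgroup G).lowerCentralSeries n ≤ Subgroup.center G := by
  rw [Subgroup.lowerCentralSeries_succ, Subgroup.commutator_eq_bot_iff_le_centralizer] at hn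
  simpa [Subgroup.centralizer_univ] using hn

theorem lowerCentralSeries_quotient_eq_bot {G : Type*} [Group G] (n : ℕ) :
    (⊤ : Subgroup (G ⧸ (⊤ : Subgroup G).lowerCentralSeries n)).lowerCentralSeries n = ⊥ := by
  set Z := (⊤ : Subgroup G).lowerCentralSeries n with hZ
  have hs := QuotientGroup.mk'_surjective Z
  rw [← Subgroup.map_top_of_surjective _ hs, ← Subgroup.map_lowerCentralSeries,
    Subgroup.map_eq_bot_iff, QuotientGroup.ker_mk']

theorem _root_.IsMulTorsion.of_injective {A G : Type*} [Group A] [Group G] (hG : IsMulTorsion G)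
    {i : A →* G} (hi : Function.Injective i) : IsMulTorsion A := fun a =>
  (hi.isOfFinOrder_iff (x := a)).1 (hG (i a))

theorem _root_.IsMulTorsion.quotient {G : Type*} [Group G] (hG : IsMulTorsion G)
    (N : Subgroup G) [N.Normal] : IsMulTorsion (G ⧸ N) :=
  IsMulTorsion.of_surjective (QuotientGroup.mk'_surjective N) hG

/-- The addition theorem for torsion nilpotent groups, in terms of exact sequences. -/
theorem IsFlowExtension.entropy_eq (n : ℕ) : ∀ {A G : Type u} {B : Type v} [Group A] [Group G] [Group B]
    {i : A →* G} {π : G →* B} {α : A →* A} {φ : G →* G} {β : B →* B},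
    IsFlowExtension i π α φ β → IsMulTorsion G → (⊤ : Subgroup G).lowerCentralSeries n = ⊥ →
    entropy φ = entropy α + entropy β := by
  induction n with
  | zero =>
    intro A G B _ _ _ i π α φ β h hG hn
    refine h.entropy_eq_of_le_center ?_ (hG.of_injective h.injective)
    intro x _
    have hx : x ∈ (⊤ : Subgroup G) := trivial
    rw [Subgroup.lowerCentralSeries_zero] at hn
    rw [hn, Subgroup.mem_bot] at hx
    exact hx ▸ one_mem _
  | succ n ih =>
    intro A G B _ _ _ i π α φ β h hG hn
    have hA := hG.of_injective h.injective
    set Z := (⊤ : Subgroup G).lowerCentralSeries n with hZdef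
    have hZ : ∀ x ∈ Z, φ x ∈ Z := map_mem_lowerCentralSeries φ n
    have hZc : Z ≤ Subgroup.center G := lowerCentralSeries_le_center hn
    have hZc' : ∀ z ∈ Z, ∀ g, g * z = z * g := fun z hz =>
      Subgroup.mem_center_iff.1 (hZc hz)
    have hZt : IsMulTorsion Z := hG.of_injective Z.subtype_injective
    -- the image `M` of `A` in `G / Z`, and the image `N` of `Z` in `B`
    let f : A →* G ⧸ Z := (QuotientGroup.mk' Z).comp i
    have hM : ∀ x ∈ f.range, quotientEnd φ Z hZ x ∈ f.range := by
      rintro _ ⟨a, rfl⟩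
      exact ⟨α a, congrArg (QuotientGroup.mk' Z) (h.comm_left a)⟩
    have hK : ∀ a ∈ Z.comap i, α a ∈ Z.comap i := fun a ha => by
      rw [Subgroup.mem_comap, h.comm_left]
      exact hZ _ ha
    have hN : ∀ b ∈ Z.map π, β b ∈ Z.map π := by
      rintro _ ⟨z, hz, rfl⟩
      exact ⟨φ z, hZ z hz, h.comm_right z⟩
    have hNc : Z.map π ≤ Subgroup.center B := by
      rintro _ ⟨z, hz, rfl⟩
      refine Subgroup.mem_center_iff.2 fun b => ?_
      obtain ⟨g, rfl⟩ := h.surjective b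
      rw [← map_mul, ← map_mul, hZc' z hz]
    have : (Z.map π).Normal := Subgroup.Normal.map inferInstance π h.surjective
    have hNt : IsMulTorsion (Z.map π) :=
      IsMulTorsion.of_surjective (π.subgroupMap_surjective Z) hZt
    have e₁ := (isFlowExtension_subgroup φ Z hZ).entropy_eq_of_le_center
      (by simpa using hZc) hZt
    have e₂ := (isFlowExtension_subgroup β (Z.map π) hN).entropy_eq_of_le_center
      (by simpa using hNc) hNt
    have x₃ : IsFlowExtension (Z.comap i).subtype f.rangeRestrict (restrictEnd α _ hK) α
        (restrictEnd (quotientEnd φ Z hZ) f.range hM) :=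
      { injective := Subgroup.subtype_injective _
        surjective := f.rangeRestrict_surjective
        exact := fun a => by
          rw [← MonoidHom.mem_ker, MonoidHom.ker_rangeRestrict, MonoidHom.mem_ker]
          simp [f]
        comm_left := fun _ => rfl
        comm_right := fun a =>
          Subtype.ext (congrArg (QuotientGroup.mk' Z) (h.comm_left a)) }
    have e₃ := x₃.entropy_eq_of_le_center (by
      rw [Subgroup.range_subtype]
      intro a ha
      refine Subgroup.mem_center_iff.2 fun b => h.injective ?_
      rw [map_mul, map_mul, hZc' _ ha]) (hA.of_injective (Subgroup.subtype_injective _))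
    have x₄ : IsFlowExtension (i.subgroupComap Z) (π.subgroupMap Z) (restrictEnd α _ hK)
        (restrictEnd φ Z hZ) (restrictEnd β _ hN) :=
      { injective := fun a b hab => Subtype.ext (h.injective (congrArg Subtype.val hab))
        surjective := π.subgroupMap_surjective Z
        exact := fun z => by
          constructor
          · intro hz
            obtain ⟨a, ha⟩ := (h.exact z).1 (congrArg Subtype.val hz)
            exact ⟨⟨a, by rw [Subgroup.mem_comap, ha]; exact z.2⟩, Subtype.ext ha⟩
          · rintro ⟨a, rfl⟩
            exact Subtype.ext (h.map_map_eq_one a)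
        comm_left := fun a => Subtype.ext (h.comm_left a)
        comm_right := fun z => Subtype.ext (h.comm_right z) }
    have e₄ := x₄.entropy_eq_of_le_center (fun z _ => Subgroup.mem_center_iff.2 fun w =>
      Subtype.ext (hZc' z z.2 w)) (hA.of_injective (Subgroup.subtype_injective _))
    have x₅ : IsFlowExtension f.range.subtype
        (QuotientGroup.map Z (Z.map π) π (Subgroup.le_comap_map π Z))
        (restrictEnd (quotientEnd φ Z hZ) f.range hM) (quotientEnd φ Z hZ)
        (quotientEnd β (Z.map π) hN) :=
      { injective := Subgroup.subtype_injective _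
        surjective := QuotientGroup.map_surjective_of_surjective _ _ _
          ((QuotientGroup.mk'_surjective _).comp h.surjective) _
        exact := fun q => by
          obtain ⟨g, rfl⟩ := QuotientGroup.mk'_surjective Z q
          rw [QuotientGroup.mk'_apply, QuotientGroup.map_mk, QuotientGroup.eq_one_iff]
          constructor
          · rintro ⟨z, hz, hzg⟩
            -- Dividing by `z` leaves the class of `g` in `G / Z` unchanged and moves `g` into the
            -- image of `A`.
            obtain ⟨a, ha⟩ := (h.exact (g * z⁻¹)).1 (by
              rw [map_mul, map_inv, hzg, mul_inv_cancel])
            refine ⟨⟨f a, a, rfl⟩, ?_⟩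
            change ((i a : G) : G ⧸ Z) = g
            rw [ha, QuotientGroup.eq]
            simpa using hz
          · rintro ⟨⟨_, a, rfl⟩, ha⟩
            have ha : ((i a : G) : G ⧸ Z) = g := ha
            refine ⟨(i a)⁻¹ * g, QuotientGroup.eq.1 ha, ?_⟩
            rw [map_mul, map_inv, h.map_map_eq_one, inv_one, one_mul]
        comm_left := fun _ => rfl
        comm_right := fun q => by
          obtain ⟨g, rfl⟩ := QuotientGroup.mk'_surjective Z q
          exact congrArg (QuotientGroup.mk' (Z.map π)) (h.comm_right g) }
    have e₅ := ih x₅ (hG.quotient Z) (lowerCentralSeries_quotient_eq_bot n)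
    -- Both sides become the sum of the entropies on `A ∩ Z`, `π Z`, `M` and `B / π Z`.
    rw [e₁, e₅, e₄, e₃, e₂]
    abel

end AlgEntropy

theorem theorem4p5 {G : Type*} [Group G] [Group.IsNilpotent G] (hG : IsMulTorsion G)
    (φ : G →* G) (H : Subgroup G) [H.Normal] (hH : ∀ x ∈ H, φ x ∈ H) :
    AlgEntropy.entropy φ =
      AlgEntropy.entropy (AlgEntropy.restrictEnd φ H hH) +
        AlgEntropy.entropy (AlgEntropy.quotientEnd φ H hH) := by
  obtain ⟨n, hn⟩ := Subgroup.nilpotent_iff_lowerCentralSeries.1 ‹Group.IsNilpotent G›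
  exact (AlgEntropy.isFlowExtension_subgroup φ H hH).entropy_eq n hG hn
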